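/- Let $G$ be a finite simple circular-arc graph, that is, the intersection graph of a finite family of open arcs of a circle. Let $\mathrm{lpt}(G)$ be the minimum cardinality of a set of vertices of $G$ that intersects every longest path of $G$, and let $\mathrm{lct}(G)$ be the minimum cardinality of a set of vertices of $G$ that intersects every longest cycle of $G$. If $G$ is connected, then $\mathrm{lpt}(G)\le 3$, and if $G$ is $2$-connected, then $\mathrm{lct}(G)\le 3$. -/

import Mathlib

namespace SimpleGraph

universe u
variable {V : Type u}

/-- The open arc of the circle `ℝ / ℤ` that runs counterclockwise from the angle `a` to the
angle `b` (one full turn is `1`), for `a < b`. It is the whole circle if `b > a + 1`. -/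
def openArc (a b : ℝ) : Set UnitAddCircle :=
  (fun t : ℝ => (t : UnitAddCircle)) '' Set.Ioo a b

/-- `G` is a circular-arc graph: it is the intersection graph of a family of (nonempty) open arcs
of a circle. -/
def IsCircularArc (G : SimpleGraph V) : Prop :=
  ∃ a b : V → ℝ, (∀ v, a v < b v) ∧
    ∀ v w : V, G.Adj v w ↔ v ≠ w ∧ (openArc (a v) (b v) ∩ openArc (a w) (b w)).Nonempty

/-- `G` is `k`-connected: it has more than `k` vertices, and it remains connected whenever fewer
than `k` vertices are deleted. -/
def IsVertexConnected (G : SimpleGraph V) (k : ℕ) : Prop :=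
  (k : ℕ∞) < ENat.card V ∧ ∀ S : Set V, S.encard < k → (G.induce Sᶜ).Connected

/-- `p` is a path of `G` of largest length among all paths of `G`. -/
def IsLongestPath {G : SimpleGraph V} {v w : V} (p : G.Walk v w) : Prop :=
  p.IsPath ∧ ∀ (x y : V) (q : G.Walk x y), q.IsPath → q.length ≤ p.length

/-- `c` is a cycle of `G` of largest length among all cycles of `G`. -/
def IsLongestCycle {G : SimpleGraph V} {v : V} (c : G.Walk v v) : Prop :=
  c.IsCycle ∧ ∀ (x : V) (d : G.Walk x x), d.IsCycle → d.length ≤ c.length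

/-- `S` is a set of vertices that intersects every longest path of `G`. -/
def IsLongestPathTransversal (G : SimpleGraph V) (S : Set V) : Prop :=
  ∀ (v w : V) (p : G.Walk v w), IsLongestPath p → ∃ x ∈ S, x ∈ p.support

/-- `S` is a set of vertices that intersects every longest cycle of `G`. -/
def IsLongestCycleTransversal (G : SimpleGraph V) (S : Set V) : Prop :=
  ∀ (v : V) (c : G.Walk v v), IsLongestCycle c → ∃ x ∈ S, x ∈ c.support

/-- The minimum cardinality of a longest path transversal of `G`. -/
noncomputable def lpt (G : SimpleGraph V) : ℕ∞ :=
  ⨅ (S : Set V) (_ : G.IsLongestPathTransversal S), S.encard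

/-- The minimum cardinality of a longest cycle transversal of `G`. -/
noncomputable def lct (G : SimpleGraph V) : ℕ∞ :=
  ⨅ (S : Set V) (_ : G.IsLongestCycleTransversal S), S.encard

end SimpleGraph

/-!
Two longest paths of a connected graph meet, and so do two longest cycles of a 2-connected graph:
otherwise disjoint connecting paths would join their longer halves to something longer. Moreover a
longest path or cycle is saturated: a vertex adjacent to both ends of one of its edges lies on it,
since it could be inserted into that edge.

Let `u` be the vertex with the longest arc. No other arc contains the arc of `u` together with both
of its ends, so every arc leaves a single interval on the complement of the arc of `u`, which is a
segment. A longest path that avoids `u` has all points common to two consecutive arcs in that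
segment, by saturation, so its arcs cover an interval of it. These intervals pairwise meet, hence
have a common point `t`. Among the arcs through `t`, one reaches furthest to the left and one
furthest to the right; the edge of the path at its arc through `t` has a point on one side of `t`,
which is covered by one of the two, and by saturation that vertex lies on the path.
-/

namespace CircularArc

section LinearOrder

variable {α : Type*} [LinearOrder α]

theorem ordConnected_union {s t : Set α} (hs : s.OrdConnected) (ht : t.OrdConnected)
    (hst : (s ∩ t).Nonempty) : (s ∪ t).OrdConnected := by
  obtain ⟨w, hws, hwt⟩ := hst
  have mem_of_mem_uIcc : ∀ x ∈ s ∪ t, Set.uIcc x w ⊆ s ∪ t := by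
    rintro x (hx | hx)
    · exact (hs.uIcc_subset hx hws).trans Set.subset_union_left
    · exact (ht.uIcc_subset hx hwt).trans Set.subset_union_right
  refine ⟨fun x hx y hy z hz => ?_⟩
  rcases le_total z w with hzw | hwz
  · exact mem_of_mem_uIcc x hx (Set.mem_uIcc_of_le hz.1 hzw)
  · exact mem_of_mem_uIcc y hy (Set.mem_uIcc_of_ge hwz hz.2)

theorem nonempty_biInter_of_ordConnected {ι : Type*} {s : Set ι} (hs : s.Finite)
    (hne : s.Nonempty) {F : ι → Set α} (hF : ∀ i ∈ s, (F i).OrdConnected)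
    (hinter : ∀ i ∈ s, ∀ j ∈ s, (F i ∩ F j).Nonempty) : (⋂ i ∈ s, F i).Nonempty := by
  obtain ⟨i₀, hi₀⟩ := hne
  have : Nonempty α := (hinter i₀ hi₀ i₀ hi₀).to_type
  choose! p hp using hinter
  choose! j hj hjmin using fun i (_ : i ∈ s) => Set.exists_min_image s (p i) hs ⟨i₀, hi₀⟩
  -- The common point is `max_i min_j p i j`.
  obtain ⟨k, hk, hkmax⟩ := Set.exists_max_image s (fun i => p i (j i)) hs ⟨i₀, hi₀⟩
  exact ⟨p k (j k), Set.mem_iInter₂.mpr fun i hi => (hF i hi).out (hp i hi (j i) (hj i hi)).1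
    (hp k hk i hi).2 ⟨hkmax i hi, hjmin k hk i hi⟩⟩

theorem exists_forall_inter_Iic_subset {ι : Type*} [Finite ι] {I : ι → Set α}
    (hI : ∀ i, (I i).OrdConnected) {t : α} (ht : ∃ i, t ∈ I i) :
    ∃ i, t ∈ I i ∧ ∀ j, t ∈ I j → I j ∩ Set.Iic t ⊆ I i := by
  obtain ⟨i, hi, hmax⟩ := Set.Finite.exists_maximalFor (fun j => I j ∩ Set.Iic t) {j | t ∈ I j}
    (Set.toFinite _) ht
  refine ⟨i, hi, fun j hj => ?_⟩
  by_contra hji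
  obtain ⟨x, ⟨hxj, hxt⟩, hxi⟩ := Set.not_subset.mp hji
  have hij : I i ∩ Set.Iic t ⊆ I j ∩ Set.Iic t := by
    rintro y ⟨hyi, hyt⟩
    have hxy : x ≤ y := le_of_not_ge fun hyx => hxi ((hI i).out hyi hi ⟨hyx, hxt⟩)
    exact ⟨(hI j).out hxj hj ⟨hxy, hyt⟩, hyt⟩
  exact hxi (hmax hj hij ⟨hxj, hxt⟩).1

theorem exists_forall_inter_Ici_subset {ι : Type*} [Finite ι] {I : ι → Set α}
    (hI : ∀ i, (I i).OrdConnected) {t : α} (ht : ∃ i, t ∈ I i) :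
    ∃ i, t ∈ I i ∧ ∀ j, t ∈ I j → I j ∩ Set.Ici t ⊆ I i :=
  exists_forall_inter_Iic_subset (α := αᵒᵈ) (fun i => (hI i).dual) ht

theorem exists_transversal_encard_le_two {ι : Type*} [Finite ι] {I : ι → Set α}
    (hI : ∀ i, (I i).OrdConnected) {𝓟 : Set (Set ι)}
    (hconn : ∀ P ∈ 𝓟, (⋃ i ∈ P, I i).OrdConnected)
    (hsat : ∀ P ∈ 𝓟, ∀ i ∈ P, ∃ s ∈ I i, ∀ j, s ∈ I j → j ∈ P)
    (hinter : ∀ P ∈ 𝓟, ∀ Q ∈ 𝓟, (P ∩ Q).Nonempty) :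
    ∃ S : Set ι, S.encard ≤ 2 ∧ ∀ P ∈ 𝓟, (S ∩ P).Nonempty := by
  rcases 𝓟.eq_empty_or_nonempty with rfl | h𝓟
  · exact ⟨∅, by simp, by simp⟩
  obtain ⟨t, ht⟩ : (⋂ P ∈ 𝓟, ⋃ i ∈ P, I i).Nonempty := by
    refine nonempty_biInter_of_ordConnected (Set.toFinite 𝓟) h𝓟 hconn fun P hP Q hQ => ?_
    obtain ⟨i, hiP, hiQ⟩ := hinter P hP Q hQ
    obtain ⟨s, hs, -⟩ := hsat P hP i hiP
    exact ⟨s, Set.mem_biUnion hiP hs, Set.mem_biUnion hiQ hs⟩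
  have htP : ∀ P ∈ 𝓟, ∃ i ∈ P, t ∈ I i := by simpa using ht
  have ht' : ∃ i, t ∈ I i := h𝓟.elim fun P hP => (htP P hP).imp fun _ => And.right
  obtain ⟨y, -, hy⟩ := exists_forall_inter_Iic_subset hI ht'
  obtain ⟨z, -, hz⟩ := exists_forall_inter_Ici_subset hI ht'
  refine ⟨{y, z}, (Set.encard_insert_le _ _).trans (by simp [one_add_one_eq_two]), fun P hP => ?_⟩
  obtain ⟨i, hiP, hi⟩ := htP P hP
  obtain ⟨s, hs, hsP⟩ := hsat P hP i hiP
  rcases le_total s t with hst | hts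
  · exact ⟨y, by simp, hsP y (hy i hi ⟨hs, hst⟩)⟩
  · exact ⟨z, by simp, hsP z (hz i hi ⟨hs, hts⟩)⟩

end LinearOrder

open SimpleGraph SimpleGraph.Walk

variable {V : Type*} {G : SimpleGraph V}

section Walk

variable {a b u v w x y : V} {A B : Set V}

theorem isPath_append {p : G.Walk u v} {q : G.Walk v w} (hp : p.IsPath) (hq : q.IsPath)
    (hpq : ∀ x ∈ p.support, x ∈ q.support → x = v) : (p.append q).IsPath := by
  have hv : v ∉ q.support.tail := by
    have := hq.support_nodup
    rw [← cons_tail_support] at this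
    exact (List.nodup_cons.mp this).1
  rw [isPath_def, support_append, List.nodup_append']
  exact ⟨hp.support_nodup, hq.support_nodup.tail,
    fun x hx hx' => hv (hpq x hx (List.mem_of_mem_tail hx') ▸ hx')⟩

theorem exists_isPath_from_last_mem (r : G.Walk u v) (h : ∃ x ∈ r.support, x ∈ A) :
    ∃ z ∈ A, ∃ q : G.Walk z v, q.IsPath ∧ q.support ⊆ r.support ∧
      ∀ x ∈ q.support, x ∈ A → x = z := by
  classical
  induction r with
  | @nil u => exact ⟨u, by simpa using h, nil, by simp, by simp, by simp⟩
  | @cons u _ _ huv r ih =>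
    by_cases hr : ∃ x ∈ r.support, x ∈ A
    · obtain ⟨z, hz, q, hq, hqr, hqA⟩ := ih hr
      exact ⟨z, hz, q, hq, List.subset_cons_of_subset u hqr, hqA⟩
    · have eq_of_mem : ∀ x ∈ (cons huv r).support, x ∈ A → x = u := fun x hx hxA =>
        (List.mem_cons.mp hx).resolve_right fun hxr => hr ⟨x, hxr, hxA⟩
      obtain ⟨x, hx, hxA⟩ := h
      exact ⟨u, eq_of_mem x hx hxA ▸ hxA, (cons huv r).bypass, bypass_isPath _,
        support_bypass_subset_support _,
        fun x hx => eq_of_mem x (support_bypass_subset_support _ hx)⟩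

/-- `p` is an `A`–`B` path in the sense of Menger's theorem: it runs from `A` to `B`, and only its
first vertex is in `A` and only its last vertex is in `B`. -/
structure IsPathBetween (A B : Set V) (p : G.Walk a b) : Prop where
  isPath : p.IsPath
  start_mem : a ∈ A
  end_mem : b ∈ B
  eq_start : ∀ x ∈ p.support, x ∈ A → x = a
  eq_end : ∀ x ∈ p.support, x ∈ B → x = b

theorem exists_isPathBetween (r : G.Walk u v) (hu : u ∈ A) (hv : v ∈ B) :
    ∃ (a b : V) (p : G.Walk a b), IsPathBetween A B p ∧ p.support ⊆ r.support := by
  obtain ⟨a, ha, q, -, hqr, hqA⟩ := exists_isPath_from_last_mem r ⟨u, r.start_mem_support, hu⟩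
  obtain ⟨b, hb, p, hp, hpq, hpB⟩ :=
    exists_isPath_from_last_mem q.reverse ⟨v, q.reverse.start_mem_support, hv⟩
  have hpq' : p.reverse.support ⊆ q.support := by simpa using hpq
  exact ⟨a, b, p.reverse, ⟨hp.reverse, ha, hb, fun x hx => hqA x (hpq' hx),
    fun x hx => hpB x (by simpa using hx)⟩, List.Subset.trans hpq' hqr⟩

namespace IsPathBetween

theorem length_pos {p : G.Walk a b} (hp : IsPathBetween A B p) (hAB : Disjoint A B) :
    0 < p.length :=
  not_nil_iff_lt_length.mp (not_nil_of_ne (hAB.ne_of_mem hp.start_mem hp.end_mem))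

theorem isPath_append_append {r : G.Walk a b} (hr : IsPathBetween A B r) (hAB : Disjoint A B)
    {p : G.Walk u a} (hp : p.IsPath) (hpA : ∀ x ∈ p.support, x ∈ A)
    {q : G.Walk b v} (hq : q.IsPath) (hqB : ∀ x ∈ q.support, x ∈ B) :
    ((p.append r).append q).IsPath := by
  refine isPath_append (isPath_append hp hr.isPath fun x hxp hxr => hr.eq_start x hxr (hpA x hxp))
    hq fun x hx hxq => ?_
  rcases (mem_support_append_iff ..).mp hx with hxp | hxr
  · exact (hAB.notMem_of_mem_left (hpA x hxp) (hqB x hxq)).elim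
  · exact hr.eq_end x hxr (hqB x hxq)

theorem isCycle_append {a₁ a₂ b₁ b₂ : V} {p : G.Walk a₁ b₁} {q : G.Walk a₂ b₂}
    (hp : IsPathBetween A B p) (hq : IsPathBetween A B q) (hpq : p.support.Disjoint q.support)
    (hAB : Disjoint A B) {c : G.Walk a₁ a₂} (hc : c.IsPath) (hcA : ∀ x ∈ c.support, x ∈ A)
    {d : G.Walk b₂ b₁} (hd : d.IsPath) (hdB : ∀ x ∈ d.support, x ∈ B) :
    (((c.append q).append d).append p.reverse).IsCycle := by
  have hcqd : ((c.append q).append d).IsPath := hq.isPath_append_append hAB hc hcA hd hdB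
  have ha : a₁ ≠ a₂ := fun h => hpq p.start_mem_support (h ▸ q.start_mem_support)
  have hc_pos : 0 < c.length := not_nil_iff_lt_length.mp (not_nil_of_ne ha)
  have hq_pos := hq.length_pos hAB
  refine hcqd.isCycle_append hp.isPath.reverse (fun x hx hxp => ?_)
    (Or.inl (by simp only [length_append]; omega))
  have hxa : x ≠ a₁ := fun h => by
    have := hcqd.support_nodup
    rw [← cons_tail_support, List.nodup_cons] at this
    exact this.1 (h ▸ hx)
  have hxb : x ≠ b₁ := fun h => by
    have := hp.isPath.reverse.support_nodup
    rw [← cons_tail_support, List.nodup_cons] at this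
    exact this.1 (h ▸ hxp)
  have hxp' : x ∈ p.support := by simpa using List.mem_of_mem_tail hxp
  have hx' := List.mem_of_mem_tail hx
  simp only [mem_support_append_iff] at hx'
  rcases hx' with (hxc | hxq) | hxd
  · exact hxa (hp.eq_start x hxp' (hcA x hxc))
  · exact hpq hxp' hxq
  · exact hxb (hp.eq_end x hxp' (hdB x hxd))

end IsPathBetween

theorem exists_half_of_isPath {p : G.Walk u v} (hp : p.IsPath) (hw : w ∈ p.support) :
    ∃ (s : V) (q : G.Walk s w),
      q.IsPath ∧ (∀ x ∈ q.support, x ∈ p.support) ∧ p.length ≤ 2 * q.length := by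
  obtain ⟨q, r, hq, hr, rfl⟩ := hp.mem_support_iff_exists_append.mp hw
  have hlen := length_append q r
  rcases le_total q.length r.length with h | h
  · exact ⟨v, r.reverse, hr.reverse, fun x hx => by simp_all, by rw [length_reverse]; omega⟩
  · exact ⟨u, q, hq, fun x hx => by simp_all, by omega⟩

theorem exists_half_of_isCycle {c : G.Walk u u} (hc : c.IsCycle) (hv : v ∈ c.support)
    (hw : w ∈ c.support) (hvw : v ≠ w) :
    ∃ p : G.Walk v w,
      p.IsPath ∧ (∀ x ∈ p.support, x ∈ c.support) ∧ c.length ≤ 2 * p.length := by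
  classical
  wlog huv : u = v generalizing u c
  · simpa using this ((isCycle_rotate hv).mpr hc) (start_mem_support _) (by simpa using hw) rfl
  subst huv
  obtain ⟨q, r, rfl⟩ := c.mem_support_iff_exists_append.mp hw
  have hlen := length_append q r
  rcases le_total q.length r.length with h | h
  · exact ⟨r.reverse, (hc.isPath_of_append_right (not_nil_of_ne hvw)).reverse,
      fun x hx => by simp_all, by rw [length_reverse]; omega⟩
  · exact ⟨q, hc.isPath_of_append_left (not_nil_of_ne hvw.symm), fun x hx => by simp_all,
      by omega⟩

theorem nontrivial_support_of_isCycle {c : G.Walk v v} (hc : c.IsCycle) :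
    {x | x ∈ c.support}.Nontrivial :=
  ⟨v, c.start_mem_support, c.snd, c.getVert_mem_support 1, (c.adj_snd hc.not_nil).ne⟩

end Walk

section VertexConnected

variable {s t v w x y z : V} {A B : Set V}

theorem exists_walk_avoiding {k : ℕ} (hG : G.IsVertexConnected k) {S : Set V} (hS : S.encard < k)
    (hx : x ∉ S) (hy : y ∉ S) : ∃ r : G.Walk x y, ∀ z ∈ r.support, z ∉ S := by
  obtain ⟨r⟩ := (hG.2 S hS).preconnected ⟨x, hx⟩ ⟨y, hy⟩
  refine ⟨r.map (Embedding.induce Sᶜ).toHom, fun z hz => ?_⟩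
  obtain ⟨z', -, rfl⟩ := List.mem_map.mp (Walk.support_map (Embedding.induce Sᶜ).toHom r ▸ hz)
  exact z'.2

theorem exists_isPath_disjoint_of_mem_support {p : G.Walk s v} {q : G.Walk t v} (hp : p.IsPath)
    (hpq : ∀ x ∈ p.support, x ∈ q.support → x = v) {r : G.Walk z w} (hr : r.IsPath)
    (hv : v ∉ r.support) (hz : z ∈ p.support)
    (hrpq : ∀ x ∈ r.support, x ∈ p.support ∨ x ∈ q.support → x = z) :
    ∃ p' : G.Walk s w, p'.IsPath ∧ p'.support.Disjoint q.support := by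
  classical
  have hsub := p.support_takeUntil_subset_support hz
  have hvz : v ≠ z := fun h => hv (h ▸ r.start_mem_support)
  refine ⟨(p.takeUntil z hz).append r, isPath_append (hp.takeUntil hz) hr fun x hxp hxr =>
    hrpq x hxr (Or.inl (hsub hxp)), fun x hx hxq => ?_⟩
  rcases (mem_support_append_iff ..).mp hx with hxp | hxr
  · obtain rfl := hpq x (hsub hxp) hxq
    exact endpoint_notMem_support_takeUntil hp hz hvz hxp
  · obtain rfl := hrpq x hxr (Or.inr hxq)
    exact hvz (hpq x hz hxq).symm

theorem exists_disjoint_isPath_of_fan {a : V} (ha : a ∈ A) (hs : s ∈ A) (ht : t ∈ A)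
    {r : G.Walk a w} (hr : v ∉ r.support) {p : G.Walk s v} {q : G.Walk t v} (hp : p.IsPath)
    (hq : q.IsPath) (hpq : ∀ x ∈ p.support, x ∈ q.support → x = v) :
    ∃ s ∈ A, ∃ t ∈ A, ∃ (p : G.Walk s w) (q : G.Walk t v),
      p.IsPath ∧ q.IsPath ∧ p.support.Disjoint q.support := by
  classical
  by_cases hrpq : ∃ x ∈ r.support, x ∈ {x | x ∈ p.support ∨ x ∈ q.support}
  · -- Follow the fan up to the last vertex of `r` on it, then follow `r`.
    obtain ⟨z, hz, r', hr', hrr, hlast⟩ := exists_isPath_from_last_mem r hrpq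
    have hv : v ∉ r'.support := fun h => hr (hrr h)
    rcases hz with hzp | hzq
    · obtain ⟨p', hp', hpq'⟩ := exists_isPath_disjoint_of_mem_support hp hpq hr' hv hzp hlast
      exact ⟨s, hs, t, ht, p', q, hp', hq, hpq'⟩
    · obtain ⟨q', hq', hqp'⟩ := exists_isPath_disjoint_of_mem_support hq
        (fun x hxq hxp => hpq x hxp hxq) hr' hv hzq fun x hx h => hlast x hx h.symm
      exact ⟨t, ht, s, hs, q', p, hq', hp, hqp'⟩
  · exact ⟨a, ha, t, ht, r.bypass, q, bypass_isPath r, hq, fun x hx hxq =>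
      hrpq ⟨x, support_bypass_subset_support r hx, Or.inr hxq⟩⟩

theorem exists_fan (hG : G.IsVertexConnected 2) (hA : A.Nontrivial) (v : V) :
    ∃ s ∈ A, ∃ t ∈ A, ∃ (p : G.Walk s v) (q : G.Walk t v),
      p.IsPath ∧ q.IsPath ∧ ∀ x ∈ p.support, x ∈ q.support → x = v := by
  obtain ⟨b, hb⟩ := hA.nonempty
  -- The fan at `b` is trivial; move it to `v` one edge at a time.
  obtain ⟨r, -⟩ : ∃ r : G.Walk v b, ∀ z ∈ r.support, z ∉ (∅ : Set V) :=
    exists_walk_avoiding hG (by simp) (by simp) (by simp)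
  induction r with
  | @nil b => exact ⟨b, hb, b, hb, nil, nil, by simp, by simp, by simp⟩
  | @cons w v _ hwv _ ih =>
    obtain ⟨s, hs, t, ht, p, q, hp, hq, hpq⟩ := ih hb
    obtain ⟨a, ha, hav⟩ := hA.exists_ne v
    obtain ⟨r, hr⟩ := exists_walk_avoiding hG (S := {v}) (by simp) hav hwv.ne
    obtain ⟨s, hs, t, ht, p, q, hp, hq, hpq⟩ := exists_disjoint_isPath_of_fan ha hs ht
      (fun h => hr v h rfl) hp hq hpq
    refine ⟨s, hs, t, ht, p, q.concat hwv.symm, hp, hq.concat (hpq p.end_mem_support) _,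
      fun x hxp hxq => ?_⟩
    rw [support_concat, List.mem_append, List.mem_singleton] at hxq
    exact hxq.resolve_left (hpq hxp)

theorem exists_disjoint_isPathBetween (hG : G.IsVertexConnected 2) (hA : A.Nontrivial)
    (hB : B.Nontrivial) : ∃ (a₁ b₁ a₂ b₂ : V) (p : G.Walk a₁ b₁) (q : G.Walk a₂ b₂),
      IsPathBetween A B p ∧ IsPathBetween A B q ∧ p.support.Disjoint q.support := by
  obtain ⟨d, hd, e, he, hde⟩ := hB
  obtain ⟨s, hs, t, ht, p, q, hp, hq, hpq⟩ := exists_fan hG hA d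
  obtain ⟨a, ha, had⟩ := hA.exists_ne d
  obtain ⟨r, hr⟩ := exists_walk_avoiding hG (S := {d}) (by simp) had hde.symm
  obtain ⟨s, hs, t, ht, p, q, -, -, hpq⟩ := exists_disjoint_isPath_of_fan ha hs ht
    (fun h => hr d h rfl) hp hq hpq
  obtain ⟨a₁, b₁, p', hp', hpp⟩ := exists_isPathBetween p hs he
  obtain ⟨a₂, b₂, q', hq', hqq⟩ := exists_isPathBetween q ht hd
  exact ⟨a₁, b₁, a₂, b₂, p', q', hp', hq', fun x hxp hxq => hpq (hpp hxp) (hqq hxq)⟩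

end VertexConnected

section Longest

variable {u v w x y : V}

theorem not_nil_of_isLongestPath {p : G.Walk v w} (hp : IsLongestPath p) (h : G.Adj x y) :
    ¬p.Nil := by
  have hlen : 1 ≤ p.length := hp.2 x y h.toWalk (by simp [h.ne])
  exact not_nil_iff_lt_length.mpr hlen

theorem exists_mem_support_of_isLongestPath (hG : G.Connected) {p : G.Walk u v} {q : G.Walk x y}
    (hp : IsLongestPath p) (hq : IsLongestPath q) : ∃ z ∈ p.support, z ∈ q.support := by
  by_contra! h
  have hdisj : Disjoint {z | z ∈ p.support} {z | z ∈ q.support} := Set.disjoint_left.mpr h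
  obtain ⟨r₀⟩ := hG.preconnected u x
  obtain ⟨a, b, r, hr, -⟩ := exists_isPathBetween (A := {z | z ∈ p.support})
    (B := {z | z ∈ q.support}) r₀ p.start_mem_support q.start_mem_support
  obtain ⟨s, p', hp', hpp, hplen⟩ := exists_half_of_isPath hp.1 hr.start_mem
  obtain ⟨t, q', hq', hqq, hqlen⟩ := exists_half_of_isPath hq.1 hr.end_mem
  have hpath := hr.isPath_append_append hdisj hp' hpp hq'.reverse (by simpa using hqq)
  have hp_le := hp.2 _ _ _ hpath
  have hq_le := hq.2 _ _ _ hpath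
  have hr_pos := hr.length_pos hdisj
  simp only [length_append, length_reverse] at hp_le hq_le
  omega

theorem exists_mem_support_of_isLongestCycle (hG : G.IsVertexConnected 2) {c : G.Walk v v}
    {d : G.Walk w w} (hc : IsLongestCycle c) (hd : IsLongestCycle d) :
    ∃ z ∈ c.support, z ∈ d.support := by
  by_contra! h
  have hdisj : Disjoint {z | z ∈ c.support} {z | z ∈ d.support} := Set.disjoint_left.mpr h
  obtain ⟨a₁, b₁, a₂, b₂, p, q, hp, hq, hpq⟩ := exists_disjoint_isPathBetween hG
    (nontrivial_support_of_isCycle hc.1) (nontrivial_support_of_isCycle hd.1)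
  have ha : a₁ ≠ a₂ := fun h => hpq p.start_mem_support (h ▸ q.start_mem_support)
  have hb : b₂ ≠ b₁ := fun h => hpq p.end_mem_support (h ▸ q.end_mem_support)
  obtain ⟨c', hc', hcc, hclen⟩ := exists_half_of_isCycle hc.1 hp.start_mem hq.start_mem ha
  obtain ⟨d', hd', hdd, hdlen⟩ := exists_half_of_isCycle hd.1 hq.end_mem hp.end_mem hb
  have hcycle := hp.isCycle_append hq hpq hdisj hc' hcc hd' hdd
  have hc_le := hc.2 _ _ hcycle
  have hd_le := hd.2 _ _ hcycle
  have hp_pos := hp.length_pos hdisj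
  simp only [length_append, length_reverse] at hc_le hd_le
  omega

/-- A walk is saturated if no vertex outside it is adjacent to both ends of one of its edges. For a
path or a cycle this says that it cannot be lengthened by inserting a vertex into an edge. -/
def IsSaturated (p : G.Walk v w) : Prop :=
  ∀ d ∈ p.darts, ∀ x, G.Adj x d.fst → G.Adj x d.snd → x ∈ p.support

theorem exists_eq_append_cons_of_mem_darts {d : G.Dart} {p : G.Walk v w} (hd : d ∈ p.darts) :
    ∃ (q : G.Walk v d.fst) (r : G.Walk d.snd w), p = q.append (cons d.adj r) := by
  obtain ⟨q, r, rfl⟩ := (isSubwalk_toWalk_adj_iff_mem_darts p).mpr hd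
  exact ⟨q, r, (append_assoc q d.adj.toWalk r).symm⟩

theorem isSaturated_of_isLongestPath {p : G.Walk v w} (hp : IsLongestPath p) : IsSaturated p := by
  intro d hd x h₁ h₂
  by_contra hx
  obtain ⟨q, r, rfl⟩ := exists_eq_append_cons_of_mem_darts hd
  have hpath : (q.append (cons h₁.symm (cons h₂ r))).IsPath := by
    have hnd := hp.1.support_nodup
    simp only [mem_support_append_iff, support_cons, List.mem_cons, not_or] at hx
    simp only [isPath_def, support_append, support_cons, List.tail_cons, List.nodup_append',
      List.nodup_cons, List.disjoint_cons_right] at hnd ⊢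
    exact ⟨hnd.1, ⟨hx.2.2, hnd.2.1⟩, hx.1, hnd.2.2⟩
  have hlen := hp.2 _ _ _ hpath
  simp only [length_append, length_cons] at hlen
  omega

theorem isSaturated_of_isLongestCycle {c : G.Walk v v} (hc : IsLongestCycle c) :
    IsSaturated c := by
  intro d hd x h₁ h₂
  by_contra hx
  obtain ⟨q, r, rfl⟩ := exists_eq_append_cons_of_mem_darts hd
  have hrq : (r.append q).IsPath := by
    have hnd := hc.1.support_nodup
    rw [tail_support_append, List.nodup_append_comm] at hnd
    rwa [isPath_def, support_append]
  have hx' : x ∉ (r.append q).support := by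
    simp only [mem_support_append_iff, not_or] at hx ⊢
    exact ⟨fun h => hx.2 (List.mem_cons_of_mem _ h), hx.1⟩
  have hcycle : (cons h₁.symm (cons h₂ (r.append q))).IsCycle := by
    refine (cons_isCycle_iff _ _).mpr ⟨hrq.cons hx', fun h => ?_⟩
    rw [edges_cons, List.mem_cons, Sym2.eq_swap] at h
    rcases h with h | h
    · exact d.adj.ne (Sym2.congr_right.mp h)
    · exact hx' (fst_mem_support_of_mem_edges _ h)
  have hlen := hc.2 _ _ hcycle
  simp only [length_append, length_cons] at hlen
  omega

end Longest

section IntersectionGraph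

variable {X : Type*} {A : V → Set X} {u v w : V}

/-- `G` is the intersection graph of the sets `A v`, which may be empty or repeat. -/
def IsIntersectionRepresentation (G : SimpleGraph V) (A : V → Set X) : Prop :=
  ∀ v w, G.Adj v w ↔ v ≠ w ∧ (A v ∩ A w).Nonempty

theorem mem_support_of_isSaturated (hA : IsIntersectionRepresentation G A) {p : G.Walk v w}
    (hp : IsSaturated p) {d : G.Dart} (hd : d ∈ p.darts) {t : X} (hfst : t ∈ A d.fst)
    (hsnd : t ∈ A d.snd) {x : V} (hx : t ∈ A x) : x ∈ p.support := by
  by_cases hxfst : x = d.fst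
  · exact hxfst ▸ dart_fst_mem_support_of_mem_darts p hd
  by_cases hxsnd : x = d.snd
  · exact hxsnd ▸ dart_snd_mem_support_of_mem_darts p hd
  exact hp d hd x ((hA _ _).mpr ⟨hxfst, t, hx, hfst⟩) ((hA _ _).mpr ⟨hxsnd, t, hx, hsnd⟩)

theorem exists_mem_preimage_of_mem_darts {α : Type*} {f : α → X}
    (hA : IsIntersectionRepresentation G A) (hf : (A u)ᶜ ⊆ Set.range f) {p : G.Walk v w}
    (hp : IsSaturated p) (hu : u ∉ p.support) {d : G.Dart} (hd : d ∈ p.darts) :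
    ∃ t, f t ∈ A d.fst ∧ f t ∈ A d.snd ∧ ∀ x, f t ∈ A x → x ∈ p.support := by
  obtain ⟨-, s, hfst, hsnd⟩ := (hA _ _).mp d.adj
  have hs : ∀ x, s ∈ A x → x ∈ p.support := fun x hx =>
    mem_support_of_isSaturated hA hp hd hfst hsnd hx
  obtain ⟨t, rfl⟩ := hf fun hsu => hu (hs u hsu)
  exact ⟨t, hfst, hsnd, hs⟩

variable {α : Type*} [LinearOrder α]

theorem ordConnected_biUnion_support {I : V → Set α} (hI : ∀ v, (I v).OrdConnected)
    (p : G.Walk v w) (hp : ∀ d ∈ p.darts, (I d.fst ∩ I d.snd).Nonempty) :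
    (⋃ x ∈ p.support, I x).OrdConnected := by
  induction p with
  | nil => simpa using hI _
  | @cons u v _ huv p ih =>
    have hunion : (⋃ x ∈ (cons huv p).support, I x) = I u ∪ ⋃ x ∈ p.support, I x := by
      simp only [support_cons, List.mem_cons, Set.iUnion_iUnion_eq_or_left]
    rw [hunion]
    exact ordConnected_union (hI u) (ih fun d hd => hp d (List.mem_cons_of_mem _ hd))
      ((hp ⟨(u, v), huv⟩ (by simp)).mono
        (Set.inter_subset_inter_right _ (Set.subset_biUnion_of_mem p.start_mem_support)))

/-- `P` is the vertex set of a saturated walk that has at least one edge. Longest paths and longest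
cycles enter the argument only through this property; the walk of length zero is excluded, since it
is saturated for lack of edges. -/
def IsSaturatedVertexSet (G : SimpleGraph V) (P : Set V) : Prop :=
  ∃ (v w : V) (p : G.Walk v w), ¬p.Nil ∧ IsSaturated p ∧ {x | x ∈ p.support} = P

theorem exists_transversal_of_ordConnected_preimage [Finite V]
    (hA : IsIntersectionRepresentation G A) {f : α → X} (hf : (A u)ᶜ ⊆ Set.range f)
    (hI : ∀ v, (f ⁻¹' A v).OrdConnected) {𝓟 : Set (Set V)}
    (h𝓟 : ∀ P ∈ 𝓟, IsSaturatedVertexSet G P)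
    (hinter : ∀ P ∈ 𝓟, ∀ Q ∈ 𝓟, (P ∩ Q).Nonempty) :
    ∃ S : Set V, S.encard ≤ 3 ∧ ∀ P ∈ 𝓟, (S ∩ P).Nonempty := by
  have hconn : ∀ P ∈ {P ∈ 𝓟 | u ∉ P}, (⋃ x ∈ P, f ⁻¹' A x).OrdConnected := by
    rintro P ⟨hP, hu⟩
    obtain ⟨v, w, p, -, hp, rfl⟩ := h𝓟 P hP
    refine ordConnected_biUnion_support hI p fun d hd => ?_
    obtain ⟨t, hfst, hsnd, -⟩ := exists_mem_preimage_of_mem_darts hA hf hp hu hd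
    exact ⟨t, hfst, hsnd⟩
  have hsat : ∀ P ∈ {P ∈ 𝓟 | u ∉ P}, ∀ x ∈ P, ∃ t ∈ f ⁻¹' A x, ∀ y, t ∈ f ⁻¹' A y → y ∈ P := by
    rintro P ⟨hP, hu⟩ x hx
    obtain ⟨v, w, p, hnil, hp, rfl⟩ := h𝓟 P hP
    obtain ⟨e, he, hxe⟩ := (mem_support_iff_exists_mem_edges_of_not_nil hnil).mp hx
    obtain ⟨d, hd, rfl⟩ := List.mem_map.mp he
    obtain ⟨t, hfst, hsnd, ht⟩ := exists_mem_preimage_of_mem_darts hA hf hp hu hd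
    rcases Sym2.mem_iff.mp hxe with rfl | rfl
    · exact ⟨t, hfst, ht⟩
    · exact ⟨t, hsnd, ht⟩
  obtain ⟨S, hS, hSP⟩ := exists_transversal_encard_le_two hI hconn hsat
    fun P hP Q hQ => hinter P hP.1 Q hQ.1
  refine ⟨insert u S, ?_, fun P hP => ?_⟩
  · calc (insert u S).encard ≤ S.encard + 1 := Set.encard_insert_le S u
      _ ≤ 2 + 1 := by gcongr
      _ = 3 := by norm_num
  · by_cases hu : u ∈ P
    · exact ⟨u, Set.mem_insert u S, hu⟩
    · exact (hSP P ⟨hP, hu⟩).mono (Set.inter_subset_inter_left P (Set.subset_insert u S))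

end IntersectionGraph

section Circle

variable {a b α β : ℝ}

theorem coe_mem_openArc {t : ℝ} :
    (t : UnitAddCircle) ∈ openArc a b ↔ ∃ n : ℤ, a < t + n ∧ t + n < b := by
  constructor
  · rintro ⟨s, hs, hst⟩
    obtain ⟨n, hn⟩ := (AddCircle.coe_eq_zero_iff (1 : ℝ) (x := s - t)).mp (sub_eq_zero.mpr hst)
    obtain rfl : t + n = s := by rw [zsmul_eq_mul, mul_one] at hn; linarith
    exact ⟨n, hs⟩
  · rintro ⟨n, ha, hb⟩
    exact ⟨t + n, ⟨ha, hb⟩, by simp⟩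

theorem compl_openArc_subset_range :
    (openArc α β)ᶜ ⊆ Set.range fun t : Set.Icc β (α + 1) => ((t : ℝ) : UnitAddCircle) := by
  intro x hx
  obtain ⟨t, ht, rfl⟩ : x ∈ ((↑) : ℝ → UnitAddCircle) '' Set.Ioc α (α + 1) := by
    rw [AddCircle.coe_image_Ioc_eq]
    exact Set.mem_univ x
  have hβ : β ≤ t := le_of_not_gt fun htβ => hx ⟨t, ⟨ht.1, htβ⟩, rfl⟩
  exact ⟨⟨t, hβ, ht.2⟩, rfl⟩

theorem ordConnected_preimage_openArc (h : b - a ≤ β - α) :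
    ((fun t : Set.Icc β (α + 1) => ((t : ℝ) : UnitAddCircle)) ⁻¹' openArc a b).OrdConnected := by
  refine ⟨?_⟩
  rintro ⟨s, hs⟩ hsab ⟨t, ht⟩ htab ⟨x, hx⟩ ⟨hsx, hxt⟩
  obtain ⟨m, hma, hmb⟩ := coe_mem_openArc.mp hsab
  obtain ⟨n, hna, hnb⟩ := coe_mem_openArc.mp htab
  simp only [Subtype.mk_le_mk] at hsx hxt
  -- `s` and `t` are at most `1 - (β - α) ≤ 1 - (b - a)` apart, so both lie in the same lift of
  -- the arc.
  obtain rfl : m = n := by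
    have hmn : (m : ℝ) < n + 1 := by linarith [hs.1, ht.2]
    have hnm : (n : ℝ) < m + 1 := by linarith [hs.1, ht.2]
    norm_cast at hmn hnm
    omega
  exact coe_mem_openArc.mpr ⟨m, by linarith, by linarith⟩

theorem exists_transversal_of_isCircularArc [Finite V] (hG : G.IsCircularArc) {𝓟 : Set (Set V)}
    (h𝓟 : ∀ P ∈ 𝓟, IsSaturatedVertexSet G P)
    (hinter : ∀ P ∈ 𝓟, ∀ Q ∈ 𝓟, (P ∩ Q).Nonempty) :
    ∃ S : Set V, S.encard ≤ 3 ∧ ∀ P ∈ 𝓟, (S ∩ P).Nonempty := by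
  obtain ⟨a, b, -, hab⟩ := hG
  rcases 𝓟.eq_empty_or_nonempty with rfl | ⟨P, hP⟩
  · exact ⟨∅, by simp, by simp⟩
  have : Nonempty V := (h𝓟 P hP).nonempty
  obtain ⟨u, hu⟩ := Finite.exists_max fun v => b v - a v
  exact exists_transversal_of_ordConnected_preimage hab compl_openArc_subset_range
    (fun v => ordConnected_preimage_openArc (hu v)) h𝓟 hinter

theorem lpt_le_three [Finite V] (hG : G.IsCircularArc) (hc : G.Connected) : G.lpt ≤ 3 := by
  rcases subsingleton_or_nontrivial V with hV | hV
  · exact iInf₂_le_of_le Set.univ (fun v _ p _ => ⟨v, Set.mem_univ v, p.start_mem_support⟩)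
      ((Set.encard_le_one_iff_subsingleton.mpr (Set.subsingleton_of_subsingleton)).trans
        (by norm_num))
  let 𝓟 : Set (Set V) :=
    {P | ∃ (v w : V) (p : G.Walk v w), IsLongestPath p ∧ {x | x ∈ p.support} = P}
  have hsat : ∀ P ∈ 𝓟, IsSaturatedVertexSet G P := by
    rintro _ ⟨v, w, p, hp, rfl⟩
    obtain ⟨x, hvx⟩ := hc.preconnected.exists_adj_of_nontrivial v
    exact ⟨v, w, p, not_nil_of_isLongestPath hp hvx, isSaturated_of_isLongestPath hp, rfl⟩
  have hinter : ∀ P ∈ 𝓟, ∀ Q ∈ 𝓟, (P ∩ Q).Nonempty := by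
    rintro _ ⟨_, _, p, hp, rfl⟩ _ ⟨_, _, q, hq, rfl⟩
    exact exists_mem_support_of_isLongestPath hc hp hq
  obtain ⟨S, hS, hSP⟩ := exists_transversal_of_isCircularArc hG hsat hinter
  exact iInf₂_le_of_le S (fun v w p hp => hSP _ ⟨v, w, p, hp, rfl⟩) hS

theorem lct_le_three [Finite V] (hG : G.IsCircularArc) (hc : G.IsVertexConnected 2) :
    G.lct ≤ 3 := by
  let 𝓟 : Set (Set V) :=
    {P | ∃ (v : V) (c : G.Walk v v), IsLongestCycle c ∧ {x | x ∈ c.support} = P}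
  have hsat : ∀ P ∈ 𝓟, IsSaturatedVertexSet G P := by
    rintro _ ⟨v, c, h, rfl⟩
    exact ⟨v, v, c, h.1.not_nil, isSaturated_of_isLongestCycle h, rfl⟩
  have hinter : ∀ P ∈ 𝓟, ∀ Q ∈ 𝓟, (P ∩ Q).Nonempty := by
    rintro _ ⟨_, c, h, rfl⟩ _ ⟨_, d, h', rfl⟩
    exact exists_mem_support_of_isLongestCycle hc h h'
  obtain ⟨S, hS, hSP⟩ := exists_transversal_of_isCircularArc hG hsat hinter
  exact iInf₂_le_of_le S (fun v c h => hSP _ ⟨v, c, h, rfl⟩) hS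

end Circle

end CircularArc

theorem theorem6 {V : Type*} [Finite V] (G : SimpleGraph V) (hG : G.IsCircularArc) :
    (G.Connected → G.lpt ≤ 3) ∧ (G.IsVertexConnected 2 → G.lct ≤ 3) :=
  ⟨CircularArc.lpt_le_three hG, CircularArc.lct_le_three hG⟩
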